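/- All logarithms are to base $2$. Let $0<p<1/2$, $q=1-p$, and consider the binary symmetric channel BSC$(p)$ with noiseless feedback: inputs $X_t$ and outputs $Y_t$ are in $\{0,1\}$ and $P(Y=y\mid X=x)=q$ if $y=x$ and $p$ otherwise. Let $C$ be its capacity, $C_1=\max_{x,x'}D\big(P(Y|X=x)\,\|\,P(Y|X=x')\big)$ and $C_2=\max_y\log\frac{\max_xP(Y=y|X=x)}{\min_xP(Y=y|X=x)}$, that is, $C=1+p\log p+q\log q$, $C_1=p\log\frac pq+q\log\frac qp$, $C_2=\log\frac qp$. Let the message $\theta$ be uniform on $\{1,\dots,M\}$, $M\ge 1$, and $0<\epsilon\le 1/2$. The encoder chooses $X_t=e_t(\theta,Y_1,\dots,Y_{t-1})$; given $\theta$ and $Y_1,\dots,Y_{t-1}$, the output $Y_t$ has the law $P(Y\mid X=X_t)$. Put $\rho_i(t)=\Pr\{\theta=i\mid Y_1,\dots,Y_t\}$. Suppose the encoder is a small-enough-difference (SED) encoder: for every $t\ge1$ and all past outputs, the sets $S_x$ of the messages $i$ with $e_t(i,Y_1,\dots,Y_{t-1})=x$, $x\in\{0,1\}$, satisfy $$0\le\sum_{i\in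 S_0}\rho_i(t-1)-\sum_{i\in S_1}\rho_i(t-1)\le\min_{i\in S_0}\rho_i(t-1).$$ Transmission stops at $\tau=\min\{t\ge0:\max_i\rho_i(t)\ge1-\epsilon\}$, and the receiver decodes $\hat\theta=\arg\max_i\rho_i(\tau)$. Then $$\mathbb E[\tau]\le\frac{\log M}{C}+\left\lceil\frac{\log\frac{1-\epsilon}{\epsilon}}{C_2}\right\rceil\frac{C_2}{C_1}+\frac{pC_2}{C_1}\left(\frac{C_1+C_2}{C}-\frac{C_2}{C_1}\right)+\frac{C_1}{C}.$$ -/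

import Mathlib

open MeasureTheory ProbabilityTheory
open scoped ENNReal

noncomputable section

/-! ### Discrete memoryless channels.  All logarithms are to base 2. -/

section Channel

variable {X Y : Type*} [Fintype X] [Fintype Y]

/-- The mutual information between input and output of the channel with transition
probabilities `W x y = P(Y = y | X = x)`, for the input distribution `P`. -/
def mutualInfo (W : X → Y → ℝ) (P : X → ℝ) : ℝ :=
  ∑ x, ∑ y, P x * W x y * Real.logb 2 (W x y / ∑ x', P x' * W x' y)

/-- The Shannon capacity `C`: the maximal mutual information over all input distributions. -/
def capacity (W : X → Y → ℝ) : ℝ :=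
  sSup (mutualInfo W '' stdSimplex ℝ X)

/-- The Kullback-Leibler divergence between two distributions on the output alphabet. -/
def kullbackLeibler (P Q : Y → ℝ) : ℝ :=
  ∑ y, P y * Real.logb 2 (P y / Q y)

/-- `C₁`: the maximal divergence between two conditional output distributions. -/
def maxDivergence (W : X → Y → ℝ) : ℝ :=
  ⨆ xx : X × X, kullbackLeibler (W xx.1) (W xx.2)

/-- `C₂`: the maximal log-ratio of transition probabilities to the same output. -/
def maxLogRatio (W : X → Y → ℝ) : ℝ :=
  ⨆ y, Real.logb 2 ((⨆ x, W x y) / (⨅ x, W x y))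

end Channel

/-- The binary symmetric channel with crossover probability `p`. -/
def bsc (p : ℝ) (x y : Fin 2) : ℝ := if x = y then 1 - p else p

/-! ### Transmission with full noiseless feedback -/

section Feedback

variable {Ω : Type*} [MeasurableSpace Ω]

/-- The first `t` channel outputs. The output process is indexed from `0`, so that `Y s` is the
output of the `(s + 1)`-st channel use. -/
def history (Y : ℕ → Ω → Fin 2) (t : ℕ) (ω : Ω) : Fin t → Fin 2 := fun s => Y s ω

/-- The message `θ` is uniform on `M` messages, the `(t + 1)`-st channel input is
`e t θ (Y₁, …, Y_t)`, and, given the message and the past outputs, the next output is drawn from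
the transition probabilities `W` of the channel for this input. -/
structure IsFeedbackTransmission {M : ℕ} (μ : Measure Ω) (W : Fin 2 → Fin 2 → ℝ)
    (e : (t : ℕ) → Fin M → (Fin t → Fin 2) → Fin 2)
    (θ : Ω → Fin M) (Y : ℕ → Ω → Fin 2) : Prop where
  measurable_message : Measurable θ
  measurable_output : ∀ t, Measurable (Y t)
  uniform : ∀ i, μ.real {ω | θ ω = i} = 1 / M
  transition : ∀ (t : ℕ) (i : Fin M) (y : Fin t → Fin 2) (b : Fin 2),
    μ.real {ω | θ ω = i ∧ history Y t ω = y ∧ Y t ω = b}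
      = μ.real {ω | θ ω = i ∧ history Y t ω = y} * W (e t i y) b

/-- The posterior probability `ρ_i(t) = P(θ = i | Y₁, …, Y_t)` when the first `t` outputs
are `y`. -/
def posterior {M : ℕ} (μ : Measure Ω) (θ : Ω → Fin M) (Y : ℕ → Ω → Fin 2)
    (i : Fin M) (t : ℕ) (y : Fin t → Fin 2) : ℝ :=
  (μ[|{ω | history Y t ω = y}]).real {ω | θ ω = i}

/-- The stopping time: the first time `t` (`⊤` if there is none) at which some message has
posterior probability at least `1 - ε`. -/
def stoppingTime {M : ℕ} (μ : Measure Ω) (θ : Ω → Fin M) (Y : ℕ → Ω → Fin 2)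
    (ε : ℝ) (ω : Ω) : ℕ∞ :=
  ⨅ (t : ℕ) (_ : ∃ i, 1 - ε ≤ posterior μ θ Y i t (history Y t ω)), (t : ℕ∞)

/-- The posterior mass of the messages that the encoder maps to the input symbol `x`, when the
first `t` outputs are `y`. -/
def inputMass {M : ℕ} (μ : Measure Ω) (e : (t : ℕ) → Fin M → (Fin t → Fin 2) → Fin 2)
    (θ : Ω → Fin M) (Y : ℕ → Ω → Fin 2) (x : Fin 2) (t : ℕ) (y : Fin t → Fin 2) : ℝ :=
  ∑ i with e t i y = x, posterior μ θ Y i t y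

/-- Small-enough-difference encoding: with `S₀`, `S₁` the sets of messages that are mapped to the
inputs `0` and `1`, the posterior mass of `S₀` exceeds that of `S₁` by a nonnegative amount that
is at most the smallest posterior in `S₀`.  Equality has to be allowed at the upper end for such a
partition always to exist (three equally likely messages have none with a strict inequality);
encoders that satisfy the strict inequality are included. -/
def IsSEDEncoder {M : ℕ} (μ : Measure Ω) (e : (t : ℕ) → Fin M → (Fin t → Fin 2) → Fin 2)
    (θ : Ω → Fin M) (Y : ℕ → Ω → Fin 2) : Prop :=
  ∀ (t : ℕ) (y : Fin t → Fin 2),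
    0 ≤ inputMass μ e θ Y 0 t y - inputMass μ e θ Y 1 t y ∧
    ∀ i, e t i y = 0 →
      inputMass μ e θ Y 0 t y - inputMass μ e θ Y 1 t y ≤ posterior μ θ Y i t y

/-- Maximum a posteriori decoding: the estimate `d t y` has the largest posterior. -/
def IsMAPDecoder {M : ℕ} (μ : Measure Ω) (d : (t : ℕ) → (Fin t → Fin 2) → Fin M)
    (θ : Ω → Fin M) (Y : ℕ → Ω → Fin 2) : Prop :=
  ∀ (t : ℕ) (y : Fin t → Fin 2) (i : Fin M), posterior μ θ Y i t y ≤ posterior μ θ Y (d t y) t y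

end Feedback

end

/-! ### Logarithmic inequalities -/

/-! Follow the log-odds `u` of the transmitted message `i`. Under SED encoding, a channel use adds
`log ((1-p)/w)` with probability `1-p` and `log (p/(1-w))` with probability `p`, for some `w` in
`[p, 1/2]` (`IsSEDEncoder.exists_logOdds_step`). The drift is therefore at least `C`. Once `u ≥ 0`,
SED separates `i` from all other messages, so `w = p` and `u` moves by `± C₂` with drift `C₁`.

A potential `F(u)` bounds the expected remaining time. It is `(A - u)/C` below `0` and an exact
solution of the random walk equation above `0`; it drops by `C₁/C` at `0`. The offset `A` is tuned
so that a step across `0` still costs at least one unit (`communication_step`, `bsc_crossing_le`).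
With `N` the ceiling in the bound, `u < N C₂` before stopping, so one step stays below `(N+1) C₂`,
where `F ≥ 0`.

Hence time plus `F` is a supermartingale up to stopping, and the mean of `τ` is at most `F(-log
(M-1)) ≤ (A + log M)/C`, which is the claimed bound. The argument runs over finite sums on the tree
of output sequences (`sum_active_jointMass_le`). -/

theorem logb_two_weighted_add_le {a b x y : ℝ} (ha : 0 ≤ a) (hb : 0 ≤ b) (hx : 0 < x) (hy : 0 < y)
    (h : a * (2 * x - 1) + b * (2 * y - 1) ≤ 0) :
    a * Real.logb 2 x + b * Real.logb 2 y ≤ -(a + b) := by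
  -- Tangent line of the concave function `logb 2` at `1/2`.
  have key : ∀ z : ℝ, 0 < z → Real.logb 2 z ≤ (2 * z - 1) / Real.log 2 - 1 := by
    intro z hz
    have h1 := Real.log_le_sub_one_of_pos (show 0 < 2 * z by positivity)
    rw [Real.log_mul (by norm_num) hz.ne'] at h1
    have h2 : 0 < Real.log 2 := Real.log_pos (by norm_num)
    rw [Real.logb, le_sub_iff_add_le, div_add_one h2.ne']
    gcongr
    linarith
  have h1 := mul_le_mul_of_nonneg_left (key x hx) ha
  have h2 := mul_le_mul_of_nonneg_left (key y hy) hb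
  have h3 : (a * (2 * x - 1) + b * (2 * y - 1)) / Real.log 2 ≤ 0 :=
    div_nonpos_of_nonpos_of_nonneg h (Real.log_nonneg (by norm_num))
  have h4 : (a * (2 * x - 1) + b * (2 * y - 1)) / Real.log 2
    = a * ((2 * x - 1) / Real.log 2) + b * ((2 * y - 1) / Real.log 2) := by ring
  linarith

/-- The binary entropy in bits. -/
theorem mul_logb_two_add_mul_logb_two (x : ℝ) :
    x * Real.logb 2 x + (1 - x) * Real.logb 2 (1 - x) = -(Real.binEntropy x / Real.log 2) := by
  rw [Real.binEntropy, Real.logb, Real.logb, Real.log_inv, Real.log_inv]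
  ring

theorem binEntropy_div_log_two_lt_one {p : ℝ} (hp : p ≠ 1 / 2) :
    Real.binEntropy p / Real.log 2 < 1 := by
  rw [div_lt_one (Real.log_pos (by norm_num)), Real.binEntropy_lt_log_two]
  simpa using hp

theorem binEntropy_div_log_two_le_one (p : ℝ) :
    Real.binEntropy p / Real.log 2 ≤ 1 :=
  (div_le_one (Real.log_pos (by norm_num))).2 Real.binEntropy_le_log_two

/-! ### The constants of the binary symmetric channel -/

theorem mutualInfo_bsc {p : ℝ} (hp₀ : 0 < p) (hp₁ : p < 1) {P : Fin 2 → ℝ}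
    (hP : P ∈ stdSimplex ℝ (Fin 2)) :
    mutualInfo (bsc p) P = Real.binEntropy (P 0 * (1 - p) + P 1 * p) / Real.log 2
      + (p * Real.logb 2 p + (1 - p) * Real.logb 2 (1 - p)) := by
  obtain ⟨h0, h1⟩ := hP
  rw [Fin.sum_univ_two] at h1
  have ha := h0 0
  have hb := h0 1
  have hq : 0 < 1 - p := by linarith
  have e1 : 0 < P 0 * (1 - p) + P 1 * p := by
    rcases ha.eq_or_lt with h | h
    · rw [← h] at h1 ⊢
      have : P 1 = 1 := by linarith
      rw [this]; linarith
    · positivity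
  have e2 : 0 < P 0 * p + P 1 * (1 - p) := by
    rcases ha.eq_or_lt with h | h
    · rw [← h] at h1 ⊢
      have : P 1 = 1 := by linarith
      rw [this]; linarith
    · positivity
  have e3 : P 0 * p + P 1 * (1 - p) = 1 - (P 0 * (1 - p) + P 1 * p) := by
    linear_combination -h1 * (1 - 2 * p) + 2 * h1 * (1 - p)
  have := mul_logb_two_add_mul_logb_two (P 0 * (1 - p) + P 1 * p)
  rw [← e3] at this
  simp only [mutualInfo, bsc, Fin.sum_univ_two, Fin.isValue, if_true, zero_ne_one, one_ne_zero,
    if_false]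
  rw [Real.logb_div hq.ne' e1.ne', Real.logb_div hp₀.ne' e2.ne', Real.logb_div hp₀.ne' e1.ne',
    Real.logb_div hq.ne' e2.ne']
  linear_combination (p * Real.logb 2 p + (1 - p) * Real.logb 2 (1 - p)) * h1 - this

/-- Mutual information is output entropy minus a noise entropy that does not depend on the input
law; uniform input makes the output entropy one bit. -/
theorem capacity_bsc {p : ℝ} (hp₀ : 0 < p) (hp₁ : p < 1) :
    capacity (bsc p) = 1 + p * Real.logb 2 p + (1 - p) * Real.logb 2 (1 - p) := by
  refine IsGreatest.csSup_eq ⟨⟨fun _ => 1 / 2, ?_, ?_⟩, ?_⟩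
  · exact ⟨fun _ => by norm_num, by norm_num⟩
  · rw [mutualInfo_bsc hp₀ hp₁ ⟨fun _ => by norm_num, by norm_num⟩]
    rw [show 1 / 2 * (1 - p) + 1 / 2 * p = 2⁻¹ by ring, Real.binEntropy_two_inv,
      div_self (Real.log_pos (by norm_num)).ne']
    ring
  · rintro _ ⟨P, hP, rfl⟩
    rw [mutualInfo_bsc hp₀ hp₁ hP]
    have := binEntropy_div_log_two_le_one (P 0 * (1 - p) + P 1 * p)
    linarith

theorem maxLogRatio_bsc {p : ℝ} (hp₁ : p < 1 / 2) :
    maxLogRatio (bsc p) = Real.logb 2 ((1 - p) / p) := by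
  have hsup : ∀ y, ⨆ x, bsc p x y = 1 - p := by
    intro y
    refine IsLUB.ciSup_eq (IsGreatest.isLUB ⟨⟨y, by simp [bsc]⟩, ?_⟩)
    rintro _ ⟨x, rfl⟩
    simp only [bsc]
    split_ifs <;> linarith
  have hinf : ∀ y, ⨅ x, bsc p x y = p := by
    intro y
    refine IsGLB.ciInf_eq (IsLeast.isGLB ⟨⟨y + 1, by simp [bsc]⟩, ?_⟩)
    rintro _ ⟨x, rfl⟩
    simp only [bsc]
    split_ifs <;> linarith
  simp [maxLogRatio, hsup, hinf]

theorem maxDivergence_bsc {p : ℝ} (hp₀ : 0 < p) (hp₁ : p < 1 / 2) :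
    maxDivergence (bsc p) = (1 - p - p) * Real.logb 2 ((1 - p) / p) := by
  have hq : 0 < 1 - p := by linarith
  have hlog : 0 ≤ Real.logb 2 ((1 - p) / p) :=
    Real.logb_nonneg (by norm_num) ((one_le_div hp₀).2 (by linarith))
  have hdiv : ∀ x x', kullbackLeibler (bsc p x) (bsc p x')
      = if x = x' then 0 else (1 - p - p) * Real.logb 2 ((1 - p) / p) := by
    intro x x'
    fin_cases x <;> fin_cases x' <;>
      simp [kullbackLeibler, bsc, hp₀.ne', hq.ne', Real.logb_div] <;> ring
  refine IsLUB.ciSup_eq (IsGreatest.isLUB ⟨⟨(0, 1), by simp [hdiv]⟩, ?_⟩)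
  rintro _ ⟨x, rfl⟩
  simp only [hdiv]
  split_ifs
  · exact mul_nonneg (by linarith) hlog
  · exact le_rfl

/-! ### A potential for the log-odds of the transmitted message -/

section Potential

/-- `confirmationPotential p C C₁ C₂ A N u` is the potential of log-odds `u` in the confirmation
phase, where the log-odds perform a random walk with steps `± C₂`. -/
noncomputable def confirmationPotential (p C C₁ C₂ A : ℝ) (N : ℤ) (u : ℝ) : ℝ :=
  (N - ⌊u / C₂⌋) * (C₂ / C₁)
    + p / (1 - p) * ((A + C₂ - (u - ⌊u / C₂⌋ * C₂)) / C - (N + 1) * (C₂ / C₁))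
      * (p / (1 - p)) ^ ⌊u / C₂⌋

/-- The potential of log-odds `u`: linear as long as the transmitted message has posterior
below `1 / 2`. -/
noncomputable def logOddsPotential (p C C₁ C₂ A : ℝ) (N : ℤ) (u : ℝ) : ℝ :=
  if u < 0 then (A - u) / C else confirmationPotential p C C₁ C₂ A N u

variable {p C C₁ C₂ A : ℝ} {N : ℤ} {u : ℝ}

/-- A step shifts the level `⌊u / C₂⌋` by one and keeps the residue. In the level, the linear term
loses one unit on average since `C₂ / C₁ = 1 / (1 - 2p)`, and the powers of `p / (1 - p)` are
harmonic for the walk. -/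
theorem confirmationPotential_step (hp₀ : 0 < p) (hp₁ : p < 1 / 2) (hC₂ : 0 < C₂)
    (hC₁ : C₁ = (1 - p - p) * C₂) (u : ℝ) :
    (1 - p) * confirmationPotential p C C₁ C₂ A N (u + C₂)
      + p * confirmationPotential p C C₁ C₂ A N (u - C₂)
      = confirmationPotential p C C₁ C₂ A N u - 1 := by
  have hq : 1 - p ≠ 0 := by linarith
  have hd : 1 - p - p ≠ 0 := by linarith
  have e1 : ⌊(u + C₂) / C₂⌋ = ⌊u / C₂⌋ + 1 := by
    rw [add_div, div_self hC₂.ne', Int.floor_add_one]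
  have e2 : ⌊(u - C₂) / C₂⌋ = ⌊u / C₂⌋ - 1 := by
    rw [sub_div, div_self hC₂.ne', Int.floor_sub_one]
  have hT : C₂ / C₁ = 1 / (1 - p - p) := by
    rw [hC₁]; field_simp
  have hr : p / (1 - p) ≠ 0 := div_ne_zero hp₀.ne' hq
  simp only [confirmationPotential, e1, e2, hT]
  rw [zpow_add₀ hr, zpow_sub₀ hr, zpow_one]
  push_cast
  have e3 : u + C₂ - (⌊u / C₂⌋ + 1) * C₂ = u - ⌊u / C₂⌋ * C₂ := by ring
  have e4 : u - C₂ - (⌊u / C₂⌋ - 1) * C₂ = u - ⌊u / C₂⌋ * C₂ := by ring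
  rw [e3, e4]
  generalize (A + C₂ - (u - ⌊u / C₂⌋ * C₂)) / C - (N + 1) * (1 / (1 - p - p)) = B
  generalize (p / (1 - p)) ^ ⌊u / C₂⌋ = Z
  field_simp
  ring

/-- The coefficient of the harmonic term is chosen so that level `-1` reproduces the linear branch.
A step down from `u ≥ 0` thus stays within one formula. -/
theorem logOddsPotential_eq_confirmationPotential (hp₀ : 0 < p) (hp₁ : p < 1 / 2) (hC₂ : 0 < C₂)
    (hu : -C₂ ≤ u) :
    logOddsPotential p C C₁ C₂ A N u = confirmationPotential p C C₁ C₂ A N u := by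
  rw [logOddsPotential]
  split_ifs with h
  · have hq : 1 - p ≠ 0 := by linarith
    have hk : ⌊u / C₂⌋ = -1 := by
      rw [Int.floor_eq_iff]
      constructor
      · rw [le_div_iff₀ hC₂]; push_cast; linarith
      · rw [div_lt_iff₀ hC₂]; push_cast; linarith
    rw [confirmationPotential, hk, zpow_neg_one]
    push_cast
    field_simp
    ring
  · rfl

theorem logOddsPotential_of_mem_Ico (hC₂ : 0 < C₂) (hu : 0 ≤ u) (hu' : u < C₂) :
    logOddsPotential p C C₁ C₂ A N u
      = N * (C₂ / C₁) + p / (1 - p) * ((A + C₂ - u) / C - (N + 1) * (C₂ / C₁)) := by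
  have hk : ⌊u / C₂⌋ = 0 := by
    rw [Int.floor_eq_iff]
    constructor
    · simpa using div_nonneg hu hC₂.le
    · rw [div_lt_iff₀ hC₂]; push_cast; linarith
  rw [logOddsPotential, if_neg hu.not_gt, confirmationPotential, hk]
  simp

theorem confirmation_step (hp₀ : 0 < p) (hp₁ : p < 1 / 2) (hC₂ : 0 < C₂)
    (hC₁ : C₁ = (1 - p - p) * C₂) (hu : 0 ≤ u) :
    (1 - p) * logOddsPotential p C C₁ C₂ A N (u + C₂)
      + p * logOddsPotential p C C₁ C₂ A N (u - C₂)
      = logOddsPotential p C C₁ C₂ A N u - 1 := by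
  simp only [logOddsPotential_eq_confirmationPotential hp₀ hp₁ hC₂
    (show -C₂ ≤ u + C₂ by linarith), logOddsPotential_eq_confirmationPotential hp₀ hp₁ hC₂
    (show -C₂ ≤ u - C₂ by linarith), logOddsPotential_eq_confirmationPotential hp₀ hp₁ hC₂
    (show -C₂ ≤ u by linarith)]
  exact confirmationPotential_step hp₀ hp₁ hC₂ hC₁ u

/-- The offset of the potential, for a confirmation phase of `N` levels. -/
noncomputable def potentialOffset (p C C₁ C₂ : ℝ) (N : ℤ) : ℝ :=
  N * (C₂ / C₁) * C + p * (C₂ / C₁) * (C₁ + C₂ - C * (C₂ / C₁)) + C₁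

/-- Without crossing `0`, the drift bound suffices. On crossing, the slack is smallest as `u` tends
to `0`, and `potentialOffset` is the value for which it then reduces exactly to `hcross`. -/
theorem communication_step (hp₀ : 0 < p) (hp₁ : p < 1 / 2) (hC₂ : 0 < C₂)
    (hC₁ : C₁ = (1 - p - p) * C₂) (hC : 0 < C) {a b : ℝ}
    (ha : a ≤ C₂) (hb : b ≤ 0) (hdrift : C ≤ (1 - p) * a + p * b)
    (hcross : C - p * (a + b) ≤ (1 - p) * C₁) (hu : u < 0) :
    (1 - p) * logOddsPotential p C C₁ C₂ (potentialOffset p C C₁ C₂ N) N (u + a)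
      + p * logOddsPotential p C C₁ C₂ (potentialOffset p C C₁ C₂ N) N (u + b)
      ≤ logOddsPotential p C C₁ C₂ (potentialOffset p C C₁ C₂ N) N u - 1 := by
  have hq : 1 - p ≠ 0 := by linarith
  have hd : 1 - p - p ≠ 0 := by linarith
  have e1 : logOddsPotential p C C₁ C₂ (potentialOffset p C C₁ C₂ N) N u
    = (potentialOffset p C C₁ C₂ N - u) / C := if_pos hu
  have e2 : logOddsPotential p C C₁ C₂ (potentialOffset p C C₁ C₂ N) N (u + b)
    = (potentialOffset p C C₁ C₂ N - (u + b)) / C := if_pos (by linarith)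
  rw [e1, e2]
  by_cases h : u + a < 0
  · rw [logOddsPotential, if_pos h, ← sub_nonneg]
    have : 0 ≤ ((1 - p) * a + p * b - C) / C := div_nonneg (by linarith) hC.le
    convert this using 1
    field_simp
    ring
  · rw [logOddsPotential_of_mem_Ico hC₂ (not_lt.1 h) (by linarith), ← sub_nonneg]
    have : 0 ≤ ((1 - p) * C₁ - (C - p * (a + b)) + (1 - p - p) * (-u)) / C :=
      div_nonneg (add_nonneg (by linarith) (mul_nonneg (by linarith) (by linarith))) hC.le
    convert this using 1
    have hT : C₂ / C₁ = 1 / (1 - p - p) := by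
      rw [hC₁]; field_simp
    rw [potentialOffset, hT, hC₁]
    field_simp
    ring

/-- Makes the coefficient of the harmonic term nonnegative, since the residue of `u` is below `C₂`.
-/
theorem le_potentialOffset (hp₀ : 0 < p) (hp₁ : p < 1 / 2) (hC₂ : 0 < C₂)
    (hC₁ : C₁ = (1 - p - p) * C₂) (hC : 0 < C) (hCle : C ≤ (1 - p) * C₁) :
    (N + 1) * (C₂ / C₁) * C ≤ potentialOffset p C C₁ C₂ N := by
  have hd : 0 < 1 - p - p := by linarith
  have hT : C₂ / C₁ = 1 / (1 - p - p) := by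
    rw [hC₁]; field_simp
  have h1 : C ≤ C₁ := hCle.trans (by nlinarith [mul_pos hd hC₂])
  rw [← sub_nonneg]
  have : 0 ≤ (((1 - p) * C₁ - C) + p * C₂ * (C₁ - C) / C₁) / (1 - p - p) := by
    have hC1 : 0 < C₁ := hC.trans_le h1
    refine div_nonneg (add_nonneg (by linarith) ?_) hd.le
    exact div_nonneg (mul_nonneg (by positivity) (by linarith)) hC1.le
  convert this using 1
  rw [potentialOffset, hT, hC₁]
  field_simp
  ring

theorem logOddsPotential_nonneg (hp₀ : 0 < p) (hp₁ : p < 1 / 2) (hC₂ : 0 < C₂)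
    (hC₁ : C₁ = (1 - p - p) * C₂) (hC : 0 < C) (hCle : C ≤ (1 - p) * C₁) (hN : 0 ≤ N)
    (hu : u < (N + 1) * C₂) :
    0 ≤ logOddsPotential p C C₁ C₂ (potentialOffset p C C₁ C₂ N) N u := by
  have hA := le_potentialOffset (N := N) hp₀ hp₁ hC₂ hC₁ hC hCle
  have hd : 0 < 1 - p - p := by linarith
  have hC₁' : 0 < C₁ := by rw [hC₁]; positivity
  have hN' : (0 : ℝ) ≤ N := by exact_mod_cast hN
  rw [logOddsPotential]
  split_ifs with h
  · refine div_nonneg ?_ hC.le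
    have : 0 ≤ (N + 1) * (C₂ / C₁) * C := by positivity
    linarith
  · have hk : ⌊u / C₂⌋ ≤ N := by
      rw [← Int.lt_add_one_iff, Int.floor_lt, div_lt_iff₀ hC₂]
      exact_mod_cast hu
    have hr : u - ⌊u / C₂⌋ * C₂ < C₂ := by
      have := Int.lt_floor_add_one (u / C₂)
      rw [div_lt_iff₀ hC₂] at this
      linarith
    rw [confirmationPotential]
    have hk' : (⌊u / C₂⌋ : ℝ) ≤ N := by exact_mod_cast hk
    have hr0 : 0 ≤ p / (1 - p) := div_nonneg hp₀.le (by linarith)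
    refine add_nonneg (mul_nonneg (by linarith) (by positivity))
      (mul_nonneg (mul_nonneg hr0 ?_) (zpow_nonneg hr0 _))
    rw [sub_nonneg, le_div_iff₀ hC]
    linarith

theorem logOddsPotential_zero_le (hp₀ : 0 < p) (hp₁ : p < 1 / 2) (hC₂ : 0 < C₂)
    (hC₁ : C₁ = (1 - p - p) * C₂) (hC : 0 < C) :
    logOddsPotential p C C₁ C₂ (potentialOffset p C C₁ C₂ N) N 0
      ≤ potentialOffset p C C₁ C₂ N / C := by
  have hq : 0 < 1 - p := by linarith
  have hd : 0 < 1 - p - p := by linarith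
  rw [logOddsPotential_of_mem_Ico hC₂ le_rfl hC₂, ← sub_nonneg]
  -- The difference of the two sides is exactly `C₁ / C`, the drop of the potential at `0`.
  have : 0 ≤ C₁ / C := by rw [hC₁]; positivity
  convert this using 1
  have hT : C₂ / C₁ = 1 / (1 - p - p) := by
    rw [hC₁]; field_simp
  rw [potentialOffset, hT, hC₁]
  field_simp
  ring

/-! ### Drift inequalities for the channel constants -/

theorem bsc_capacity_pos (hp₁ : p < 1 / 2)
    (hC : C = 1 + p * Real.logb 2 p + (1 - p) * Real.logb 2 (1 - p)) : 0 < C := by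
  have := mul_logb_two_add_mul_logb_two p
  have := binEntropy_div_log_two_lt_one hp₁.ne
  linarith

theorem bsc_logRatio_pos (hp₀ : 0 < p) (hp₁ : p < 1 / 2)
    (hC₂ : C₂ = Real.logb 2 ((1 - p) / p)) : 0 < C₂ := by
  rw [hC₂]
  exact Real.logb_pos (by norm_num) ((one_lt_div hp₀).2 (by linarith))

/-- By concavity `log w + log (1-w) ≤ -2`, which removes `w`; what remains is `1-2p` times the
cross-entropy bound `(1-p) log p + p log (1-p) ≤ -1`. -/
theorem bsc_crossing_le (hp₀ : 0 < p) (hp₁ : p < 1 / 2)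
    (hC : C = 1 + p * Real.logb 2 p + (1 - p) * Real.logb 2 (1 - p))
    (hC₂ : C₂ = Real.logb 2 ((1 - p) / p)) (hC₁ : C₁ = (1 - p - p) * C₂) {w : ℝ}
    (hw₀ : 0 < w) (hw₁ : w < 1) :
    C - p * (Real.logb 2 ((1 - p) / w) + Real.logb 2 (p / (1 - w))) ≤ (1 - p) * C₁ := by
  have hq : 0 < 1 - p := by linarith
  have hw : 0 < 1 - w := by linarith
  have f2 := logb_two_weighted_add_le zero_le_one zero_le_one hw₀ hw (by linarith)
  have f3 := logb_two_weighted_add_le hq.le hp₀.le hp₀ hq (by nlinarith [sq_nonneg (2 * p - 1)])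
  rw [hC₁, hC₂, hC, Real.logb_div hq.ne' hw₀.ne', Real.logb_div hp₀.ne' hw.ne',
    Real.logb_div hq.ne' hp₀.ne']
  nlinarith [mul_le_mul_of_nonneg_left f2 hp₀.le,
    mul_le_mul_of_nonneg_left f3 (show 0 ≤ 1 - p - p by linarith)]

theorem bsc_capacity_le (hp₀ : 0 < p) (hp₁ : p < 1 / 2)
    (hC : C = 1 + p * Real.logb 2 p + (1 - p) * Real.logb 2 (1 - p))
    (hC₂ : C₂ = Real.logb 2 ((1 - p) / p)) (hC₁ : C₁ = (1 - p - p) * C₂) :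
    C ≤ (1 - p) * C₁ := by
  have hq : 0 < 1 - p := by linarith
  -- At `w = p` the two increments are opposite and cancel.
  have := bsc_crossing_le hp₀ hp₁ hC hC₂ hC₁ hp₀ (by linarith)
  rwa [← Real.logb_mul (by positivity) (by positivity),
    show (1 - p) / p * (p / (1 - p)) = 1 by field_simp, Real.logb_one, mul_zero, sub_zero] at this

/-- One use of the channel decreases the potential by at least one on average. -/
theorem logOddsPotential_bsc_step (hp₀ : 0 < p) (hp₁ : p < 1 / 2)
    (hC : C = 1 + p * Real.logb 2 p + (1 - p) * Real.logb 2 (1 - p))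
    (hC₂ : C₂ = Real.logb 2 ((1 - p) / p)) (hC₁ : C₁ = (1 - p - p) * C₂) {w : ℝ}
    (hw₀ : p ≤ w) (hw₁ : w ≤ 1 / 2) (hu : 0 ≤ u → w = p) :
    (1 - p) * logOddsPotential p C C₁ C₂ (potentialOffset p C C₁ C₂ N) N
        (u + Real.logb 2 ((1 - p) / w))
      + p * logOddsPotential p C C₁ C₂ (potentialOffset p C C₁ C₂ N) N
        (u + Real.logb 2 (p / (1 - w)))
      ≤ logOddsPotential p C C₁ C₂ (potentialOffset p C C₁ C₂ N) N u - 1 := by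
  have hC₂p := bsc_logRatio_pos hp₀ hp₁ hC₂
  rcases le_or_gt 0 u with h | h
  · have e : Real.logb 2 (p / (1 - p)) = -C₂ := by
      rw [hC₂, ← Real.logb_inv, inv_div]
    rw [hu h, e, ← hC₂, ← sub_eq_add_neg]
    exact (confirmation_step hp₀ hp₁ hC₂p hC₁ h).le
  · have hq : 0 < 1 - p := by linarith
    have hw : 0 < 1 - w := by linarith
    have hw' : 0 < w := by linarith
    refine communication_step hp₀ hp₁ hC₂p hC₁ (bsc_capacity_pos hp₁ hC) ?_ ?_ ?_
      (bsc_crossing_le hp₀ hp₁ hC hC₂ hC₁ hw' (by linarith)) h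
    · rw [hC₂]
      exact Real.logb_le_logb_of_le (by norm_num) (by positivity) (by gcongr)
    · exact Real.logb_nonpos (by norm_num) (by positivity) ((div_le_one hw).2 (by linarith))
    · have f1 := logb_two_weighted_add_le hq.le hp₀.le hw' hw
        (by nlinarith [mul_nonneg (show 0 ≤ 1 - p - p by linarith) (show 0 ≤ 1 - 2 * w by linarith)])
      rw [hC, Real.logb_div hq.ne' hw'.ne', Real.logb_div hp₀.ne' hw.ne']
      linarith

end Potential
/-! ### Joint masses of the message and the past outputs -/

theorem bsc_pos {p : ℝ} (hp₀ : 0 < p) (hp₁ : p < 1) (x y : Fin 2) : 0 < bsc p x y := by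
  rw [bsc]
  split_ifs <;> linarith

theorem history_succ {Ω : Type*} (Y : ℕ → Ω → Fin 2) (t : ℕ) (ω : Ω) :
    history Y (t + 1) ω = Fin.snoc (history Y t ω) (Y t ω) :=
  (Fin.snoc_init_self (history Y (t + 1) ω)).symm

section Feedback

variable {Ω : Type*} [MeasurableSpace Ω] {M : ℕ}

theorem measurable_history {Y : ℕ → Ω → Fin 2} (hY : ∀ t, Measurable (Y t)) (t : ℕ) :
    Measurable (history Y t) :=
  measurable_pi_lambda _ fun s => hY s

/-- The probability that the message is `i` and the first `t` outputs are `y`. -/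
noncomputable def jointMass (μ : Measure Ω) (θ : Ω → Fin M) (Y : ℕ → Ω → Fin 2)
    (i : Fin M) (t : ℕ) (y : Fin t → Fin 2) : ℝ :=
  μ.real {ω | θ ω = i ∧ history Y t ω = y}

/-- The probability that the message is not `i` and the first `t` outputs are `y`. -/
noncomputable def otherMass (μ : Measure Ω) (θ : Ω → Fin M) (Y : ℕ → Ω → Fin 2)
    (i : Fin M) (t : ℕ) (y : Fin t → Fin 2) : ℝ :=
  ∑ j ∈ Finset.univ.erase i, jointMass μ θ Y j t y

/-- The base-`2` log-odds of the message `i` after the outputs `y`. -/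
noncomputable def logOdds (μ : Measure Ω) (θ : Ω → Fin M) (Y : ℕ → Ω → Fin 2)
    (i : Fin M) (t : ℕ) (y : Fin t → Fin 2) : ℝ :=
  Real.logb 2 (jointMass μ θ Y i t y / otherMass μ θ Y i t y)

variable {μ : Measure Ω} {θ : Ω → Fin M} {Y : ℕ → Ω → Fin 2}
  {W : Fin 2 → Fin 2 → ℝ} {e : (t : ℕ) → Fin M → (Fin t → Fin 2) → Fin 2} {p : ℝ}

theorem jointMass_zero (hY : IsFeedbackTransmission μ W e θ Y) (i : Fin M) (y : Fin 0 → Fin 2) :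
    jointMass μ θ Y i 0 y = 1 / M := by
  rw [jointMass, ← hY.uniform i]
  congr 1
  ext ω
  simp [Subsingleton.elim (history Y 0 ω) y]

theorem jointMass_succ (hY : IsFeedbackTransmission μ W e θ Y) (i : Fin M) (t : ℕ)
    (y : Fin t → Fin 2) (b : Fin 2) :
    jointMass μ θ Y i (t + 1) (Fin.snoc y b) = jointMass μ θ Y i t y * W (e t i y) b := by
  rw [jointMass, jointMass, ← hY.transition]
  congr 1
  ext ω
  simp [history_succ]

theorem jointMass_pos (hp₀ : 0 < p) (hp₁ : p < 1) (hY : IsFeedbackTransmission μ (bsc p) e θ Y)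
    (i : Fin M) (t : ℕ) (y : Fin t → Fin 2) : 0 < jointMass μ θ Y i t y := by
  induction t with
  | zero =>
    rw [jointMass_zero hY]
    have : 0 < M := i.pos
    positivity
  | succ t ih =>
    rw [← Fin.snoc_init_self y, jointMass_succ hY]
    exact mul_pos (ih _) (bsc_pos hp₀ hp₁ _ _)

theorem otherMass_pos (hp₀ : 0 < p) (hp₁ : p < 1) (hY : IsFeedbackTransmission μ (bsc p) e θ Y)
    (hM : 2 ≤ M) (i : Fin M) (t : ℕ) (y : Fin t → Fin 2) : 0 < otherMass μ θ Y i t y := by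
  refine Finset.sum_pos (fun j _ => jointMass_pos hp₀ hp₁ hY j t y) ?_
  rw [← Finset.card_pos, Finset.card_erase_of_mem (Finset.mem_univ _), Finset.card_univ,
    Fintype.card_fin]
  omega

theorem otherMass_zero (hY : IsFeedbackTransmission μ W e θ Y) (i : Fin M) (y : Fin 0 → Fin 2) :
    otherMass μ θ Y i 0 y = (M - 1) * (1 / M) := by
  simp only [otherMass, jointMass_zero hY, Finset.sum_const,
    Finset.card_erase_of_mem (Finset.mem_univ _), Finset.card_univ, Fintype.card_fin, nsmul_eq_mul]
  rw [Nat.cast_sub i.pos, Nat.cast_one]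

theorem jointMass_add_otherMass (i : Fin M) (t : ℕ) (y : Fin t → Fin 2) :
    jointMass μ θ Y i t y + otherMass μ θ Y i t y = ∑ j, jointMass μ θ Y j t y :=
  Finset.add_sum_erase _ (fun j => jointMass μ θ Y j t y) (Finset.mem_univ i)

theorem measureReal_history_eq [IsProbabilityMeasure μ] (hY : IsFeedbackTransmission μ W e θ Y)
    (t : ℕ) (y : Fin t → Fin 2) :
    μ.real {ω | history Y t ω = y} = ∑ j, jointMass μ θ Y j t y := by
  simp only [jointMass]
  rw [← measureReal_iUnion_fintype]
  · congr 1
    ext ω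
    simp
  · intro i j hij
    exact Set.disjoint_left.2 fun ω h h' => hij (h.1.symm.trans h'.1)
  · intro i
    exact (hY.measurable_message (measurableSet_singleton i)).inter
      (measurable_history hY.measurable_output t (measurableSet_singleton y))

theorem posterior_eq [IsProbabilityMeasure μ] (hY : IsFeedbackTransmission μ W e θ Y)
    (i : Fin M) (t : ℕ) (y : Fin t → Fin 2) :
    posterior μ θ Y i t y = jointMass μ θ Y i t y / ∑ j, jointMass μ θ Y j t y := by
  have hy : MeasurableSet {ω | history Y t ω = y} :=
    measurable_history hY.measurable_output t (measurableSet_singleton y)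
  rw [_root_.posterior, measureReal_def, cond_apply hy,
    ENNReal.toReal_mul, ENNReal.toReal_inv, ← measureReal_def, ← measureReal_def,
    measureReal_history_eq hY, jointMass, div_eq_inv_mul]
  congr 2
  ext ω
  simp [and_comm]

theorem inputMass_eq [IsProbabilityMeasure μ] (hY : IsFeedbackTransmission μ W e θ Y)
    (x : Fin 2) (t : ℕ) (y : Fin t → Fin 2) :
    inputMass μ e θ Y x t y
      = (∑ i with e t i y = x, jointMass μ θ Y i t y) / ∑ j, jointMass μ θ Y j t y := by
  simp only [inputMass, posterior_eq hY, Finset.sum_div]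

/-! ### Effect of SED encoding on the log-odds -/

/-- The mass of the messages other than `i` that share the input symbol of `i`. -/
noncomputable def sharedMass (μ : Measure Ω) (e : (t : ℕ) → Fin M → (Fin t → Fin 2) → Fin 2)
    (θ : Ω → Fin M) (Y : ℕ → Ω → Fin 2) (i : Fin M) (t : ℕ) (y : Fin t → Fin 2) : ℝ :=
  ∑ j ∈ Finset.univ.erase i, if e t j y = e t i y then jointMass μ θ Y j t y else 0

theorem sharedMass_nonneg (i : Fin M) (t : ℕ) (y : Fin t → Fin 2) :
    0 ≤ sharedMass μ e θ Y i t y :=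
  Finset.sum_nonneg fun j _ => by
    split_ifs
    exacts [measureReal_nonneg, le_rfl]

theorem sum_filter_same_input (i : Fin M) (t : ℕ) (y : Fin t → Fin 2) :
    ∑ j with e t j y = e t i y, jointMass μ θ Y j t y
      = jointMass μ θ Y i t y + sharedMass μ e θ Y i t y := by
  rw [Finset.sum_filter, ← Finset.add_sum_erase _ _ (Finset.mem_univ i), if_pos rfl, sharedMass]

theorem sum_filter_other_input (i : Fin M) (t : ℕ) (y : Fin t → Fin 2) {x : Fin 2}
    (hx : x ≠ e t i y) :
    ∑ j with e t j y = x, jointMass μ θ Y j t y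
      = otherMass μ θ Y i t y - sharedMass μ e θ Y i t y := by
  rw [Finset.sum_filter, ← Finset.add_sum_erase _ _ (Finset.mem_univ i), if_neg hx.symm, zero_add,
    otherMass, sharedMass, ← Finset.sum_sub_distrib]
  refine Finset.sum_congr rfl fun j _ => ?_
  split_ifs with h1 h2 h3
  · exact absurd (h1.symm.trans h2) hx
  · simp
  · simp
  · exact absurd (show e t j y = x by omega) h1

theorem IsSEDEncoder.sum_jointMass [IsProbabilityMeasure μ]
    (hp₀ : 0 < p) (hp₁ : p < 1) (hY : IsFeedbackTransmission μ (bsc p) e θ Y)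
    (he : IsSEDEncoder μ e θ Y) (i₀ : Fin M) (t : ℕ) (y : Fin t → Fin 2) :
    0 ≤ ∑ j with e t j y = 0, jointMass μ θ Y j t y - ∑ j with e t j y = 1, jointMass μ θ Y j t y ∧
    ∀ i, e t i y = 0 → ∑ j with e t j y = 0, jointMass μ θ Y j t y
      - ∑ j with e t j y = 1, jointMass μ θ Y j t y ≤ jointMass μ θ Y i t y := by
  have hpos : 0 < ∑ j, jointMass μ θ Y j t y :=
    Finset.sum_pos (fun j _ => jointMass_pos hp₀ hp₁ hY j t y) ⟨i₀, Finset.mem_univ _⟩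
  obtain ⟨h1, h2⟩ := he t y
  simp only [inputMass_eq hY, posterior_eq hY, ← sub_div] at h1 h2
  refine ⟨?_, fun i hi => (div_le_div_iff_of_pos_right hpos).1 (h2 i hi)⟩
  have := mul_nonneg h1 hpos.le
  rwa [div_mul_cancel₀ _ hpos.ne'] at this

/-- If `i` has input `0`, the upper SED bound at `i` cancels its own mass; if it has input `1`, the
lower bound gives even more. -/
theorem IsSEDEncoder.two_mul_sharedMass_le [IsProbabilityMeasure μ]
    (hp₀ : 0 < p) (hp₁ : p < 1) (hY : IsFeedbackTransmission μ (bsc p) e θ Y)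
    (he : IsSEDEncoder μ e θ Y) (i : Fin M) (t : ℕ) (y : Fin t → Fin 2) :
    2 * sharedMass μ e θ Y i t y ≤ otherMass μ θ Y i t y := by
  obtain ⟨h1, h2⟩ := he.sum_jointMass hp₀ hp₁ hY i t y
  have hs := sum_filter_same_input (μ := μ) (θ := θ) (Y := Y) (e := e) i t y
  have hw := jointMass_pos hp₀ hp₁ hY i t y
  rcases Fin.exists_fin_two.1 ⟨e t i y, rfl⟩ with h | h
  · have ho := sum_filter_other_input (μ := μ) (θ := θ) (Y := Y) (e := e) i t y
      (x := 1) (by rw [h]; decide)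
    rw [h] at hs
    have := h2 i h
    linarith
  · have ho := sum_filter_other_input (μ := μ) (θ := θ) (Y := Y) (e := e) i t y
      (x := 0) (by rw [h]; decide)
    rw [h] at hs
    linarith

/-- A companion `j` of `i` in `S₀` would bound the difference of the masses by its own mass, which
is too small when `i` outweighs all others. For `i` in `S₁` the lower bound suffices. -/
theorem IsSEDEncoder.sharedMass_eq_zero [IsProbabilityMeasure μ]
    (hp₀ : 0 < p) (hp₁ : p < 1) (hY : IsFeedbackTransmission μ (bsc p) e θ Y)
    (he : IsSEDEncoder μ e θ Y) (i : Fin M) (t : ℕ) (y : Fin t → Fin 2)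
    (hi : otherMass μ θ Y i t y ≤ jointMass μ θ Y i t y) :
    sharedMass μ e θ Y i t y = 0 := by
  obtain ⟨h1, h2⟩ := he.sum_jointMass hp₀ hp₁ hY i t y
  have hs := sum_filter_same_input (μ := μ) (θ := θ) (Y := Y) (e := e) i t y
  have h0 := sharedMass_nonneg (μ := μ) (θ := θ) (Y := Y) (e := e) i t y
  rcases Fin.exists_fin_two.1 ⟨e t i y, rfl⟩ with h | h
  · have ho := sum_filter_other_input (μ := μ) (θ := θ) (Y := Y) (e := e) i t y
      (x := 1) (by rw [h]; decide)
    by_contra hne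
    obtain ⟨j, hj, hj'⟩ := Finset.exists_ne_zero_of_sum_ne_zero hne
    have hij : e t j y = e t i y := by
      by_contra hc
      exact hj' (if_neg hc)
    have hle : jointMass μ θ Y j t y ≤ sharedMass μ e θ Y i t y := by
      refine le_trans (if_pos hij).ge (Finset.single_le_sum
        (f := fun j => if e t j y = e t i y then jointMass μ θ Y j t y else 0)
        (fun k _ => ?_) hj)
      split_ifs
      exacts [measureReal_nonneg, le_rfl]
    rw [h] at hs
    have := h2 j (hij.trans h)
    exact hne (le_antisymm (by linarith) h0)
  · have ho := sum_filter_other_input (μ := μ) (θ := θ) (Y := Y) (e := e) i t y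
      (x := 0) (by rw [h]; decide)
    rw [h] at hs
    linarith

theorem otherMass_succ (hY : IsFeedbackTransmission μ (bsc p) e θ Y) (i : Fin M) (t : ℕ)
    (y : Fin t → Fin 2) (b : Fin 2) :
    otherMass μ θ Y i (t + 1) (Fin.snoc y b)
      = if b = e t i y then p * otherMass μ θ Y i t y + (1 - p - p) * sharedMass μ e θ Y i t y
        else (1 - p) * otherMass μ θ Y i t y - (1 - p - p) * sharedMass μ e θ Y i t y := by
  simp only [otherMass, sharedMass, jointMass_succ hY, bsc]
  split_ifs with h
  · rw [Finset.mul_sum, Finset.mul_sum, ← Finset.sum_add_distrib]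
    refine Finset.sum_congr rfl fun j _ => ?_
    subst h
    split_ifs <;> ring
  · rw [Finset.mul_sum, Finset.mul_sum, ← Finset.sum_sub_distrib]
    refine Finset.sum_congr rfl fun j _ => ?_
    by_cases h1 : e t j y = b
    · have h2 : e t j y ≠ e t i y := fun h2 => h (h1.symm.trans h2)
      rw [if_pos h1, if_neg h2]
      ring
    · have h2 : e t j y = e t i y := by omega
      rw [if_neg h1, if_pos h2]
      ring

/-- The log-odds step under SED encoding; `w` is the conditional probability, given that the
message is not `i`, that the output is the input symbol of `i`. -/
theorem IsSEDEncoder.exists_logOdds_step [IsProbabilityMeasure μ]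
    (hp₀ : 0 < p) (hp₁ : p < 1 / 2) (hY : IsFeedbackTransmission μ (bsc p) e θ Y)
    (he : IsSEDEncoder μ e θ Y) (hM : 2 ≤ M) (i : Fin M) (t : ℕ) (y : Fin t → Fin 2) :
    ∃ w, p ≤ w ∧ w ≤ 1 / 2 ∧ (0 ≤ logOdds μ θ Y i t y → w = p) ∧
      ∀ b, logOdds μ θ Y i (t + 1) (Fin.snoc y b) = logOdds μ θ Y i t y +
        if b = e t i y then Real.logb 2 ((1 - p) / w) else Real.logb 2 (p / (1 - w)) := by
  have hq : 0 < 1 - p := by linarith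
  have hd : 0 < 1 - p - p := by linarith
  have hw := jointMass_pos hp₀ (by linarith) hY i t y
  have hR := otherMass_pos hp₀ (by linarith) hY hM i t y
  have hS := sharedMass_nonneg (μ := μ) (θ := θ) (Y := Y) (e := e) i t y
  have hSR := he.two_mul_sharedMass_le hp₀ (by linarith) hY i t y
  have hS0 := he.sharedMass_eq_zero hp₀ (by linarith) hY i t y
  have hstep := otherMass_succ hY i t y
  simp only [logOdds, hstep, jointMass_succ hY]
  generalize jointMass μ θ Y i t y = m at *
  generalize otherMass μ θ Y i t y = R at *
  generalize sharedMass μ e θ Y i t y = S at *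
  have hw₁ : p + (1 - p - p) * (S / R) ≤ 1 / 2 := by
    have : S / R ≤ 1 / 2 := by rw [div_le_iff₀ hR]; linarith
    nlinarith
  have hw₀ : p ≤ p + (1 - p - p) * (S / R) := by
    have : 0 ≤ (1 - p - p) * (S / R) := by positivity
    linarith
  refine ⟨p + (1 - p - p) * (S / R), hw₀, hw₁, fun h => ?_, fun b => ?_⟩
  · have : R ≤ m := by
      by_contra! hlt
      exact (Real.logb_neg (by norm_num) (by positivity) ((div_lt_one hR).2 hlt)).not_ge h
    simp [hS0 this]
  · have hwpos : 0 < p + (1 - p - p) * (S / R) := by linarith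
    have hwpos' : 0 < 1 - (p + (1 - p - p) * (S / R)) := by linarith
    split_ifs with h
    · have e1 : p * R + (1 - p - p) * S = R * (p + (1 - p - p) * (S / R)) := by
        field_simp
      rw [bsc, if_pos h.symm, e1, mul_div_mul_comm,
        Real.logb_mul (by positivity) (by positivity)]
    · have e1 : (1 - p) * R - (1 - p - p) * S = R * (1 - (p + (1 - p - p) * (S / R))) := by
        field_simp
        ring
      rw [bsc, if_neg (Ne.symm h), e1, mul_div_mul_comm,
        Real.logb_mul (by positivity) (by positivity)]

end Feedback
/-! ### Stopping on the tree of output sequences -/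

/-- No prefix of the output sequence `y`, including `y` itself, satisfies `halted`. -/
def IsActive (halted : (t : ℕ) → (Fin t → Fin 2) → Prop) : (t : ℕ) → (Fin t → Fin 2) → Prop
  | 0, y => ¬ halted 0 y
  | t + 1, y => IsActive halted t (Fin.init y) ∧ ¬ halted (t + 1) y

theorem IsActive.not_halted {halted : (t : ℕ) → (Fin t → Fin 2) → Prop} {t : ℕ} {y : Fin t → Fin 2}
    (h : IsActive halted t y) : ¬ halted t y := by
  cases t with
  | zero => exact h
  | succ t => exact h.2

theorem isActive_history {Ω : Type*} {halted : (t : ℕ) → (Fin t → Fin 2) → Prop}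
    {Y : ℕ → Ω → Fin 2} {t : ℕ} {ω : Ω} :
    IsActive halted t (history Y t ω) ↔ ∀ s ≤ t, ¬ halted s (history Y s ω) := by
  induction t with
  | zero => simp [IsActive]
  | succ t ih =>
    rw [IsActive, show Fin.init (history Y (t + 1) ω) = history Y t ω from rfl, ih]
    constructor
    · rintro ⟨h1, h2⟩ s hs
      rcases Nat.le_succ_iff.1 hs with h | rfl
      exacts [h1 s h, h2]
    · exact fun h => ⟨fun s hs => h s (hs.trans t.le_succ), h _ le_rfl⟩

theorem sum_snoc {t : ℕ} (f : (Fin (t + 1) → Fin 2) → ℝ) :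
    ∑ y, f y = ∑ y : Fin t → Fin 2, ∑ b, f (Fin.snoc y b) := by
  rw [← (Fin.snocEquiv fun _ => Fin 2).sum_comp, Fintype.sum_prod_type_right]
  rfl

/-- An integer-valued first hitting time is at most the number of times before it. -/
theorem iInf_coe_le_tsum {S : ℕ → Prop} [∀ t, Decidable (∀ s ≤ t, ¬ S s)] :
    (((⨅ (t : ℕ) (_ : S t), (t : ℕ∞)) : ℕ∞) : ℝ≥0∞)
      ≤ ∑' t, if ∀ s ≤ t, ¬ S s then 1 else 0 := by
  classical
  by_cases h : ∃ t, S t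
  · have h1 : (⨅ (t : ℕ) (_ : S t), (t : ℕ∞)) ≤ (Nat.find h : ℕ) :=
      iInf₂_le (Nat.find h) (Nat.find_spec h)
    refine (ENat.toENNReal_le.2 h1).trans ?_
    refine le_trans ?_ (ENNReal.sum_le_tsum (Finset.range (Nat.find h)))
    rw [Finset.sum_congr rfl fun t ht => if_pos fun s hs =>
      Nat.find_min h (hs.trans_lt (Finset.mem_range.1 ht))]
    simp
  · push Not at h
    simp [h]

/-! ### Expected stopping time and masses of active histories -/

section Feedback

variable {Ω : Type*} [MeasurableSpace Ω] {M : ℕ} {μ : Measure Ω} {θ : Ω → Fin M}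
  {Y : ℕ → Ω → Fin 2} {W : Fin 2 → Fin 2 → ℝ} {e : (t : ℕ) → Fin M → (Fin t → Fin 2) → Fin 2}
  {p : ℝ}

theorem measureReal_history_mem_le (t : ℕ) (S : (Fin t → Fin 2) → Prop) [DecidablePred S]
    [IsProbabilityMeasure μ] :
    μ.real {ω | S (history Y t ω)}
      ≤ ∑ i, ∑ y, if S y then jointMass μ θ Y i t y else 0 := by
  have hsub : {ω | S (history Y t ω)} ⊆ ⋃ i ∈ (Finset.univ : Finset (Fin M)),
      ⋃ y ∈ Finset.univ.filter S, {ω | θ ω = i ∧ history Y t ω = y} := by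
    intro ω hω
    simp only [Set.mem_iUnion]
    exact ⟨θ ω, Finset.mem_univ _, history Y t ω, by simpa using hω, rfl, rfl⟩
  refine (measureReal_mono hsub (measure_ne_top _ _)).trans
    ((measureReal_biUnion_finset_le _ _).trans ?_)
  refine Finset.sum_le_sum fun i _ => (measureReal_biUnion_finset_le _ _).trans ?_
  rw [Finset.sum_filter]
  exact le_rfl

/-- If every partial sum of the masses of the active histories is at most `c`, the stopping time
has expectation at most `c`. -/
theorem lintegral_stoppingTime_le [IsProbabilityMeasure μ] (hY : IsFeedbackTransmission μ W e θ Y)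
    {ε c : ℝ} {S : (t : ℕ) → (Fin t → Fin 2) → Prop} [∀ t, DecidablePred (IsActive S t)]
    (hS : S = fun t y => ∃ i, 1 - ε ≤ _root_.posterior μ θ Y i t y)
    (h : ∀ n, ∑ t ∈ Finset.range n,
      ∑ i, ∑ y, (if IsActive S t y then jointMass μ θ Y i t y else 0) ≤ c) :
    ∫⁻ ω, (stoppingTime μ θ Y ε ω : ℝ≥0∞) ∂μ ≤ ENNReal.ofReal c := by
  have hmeas : ∀ t, MeasurableSet {ω | IsActive S t (history Y t ω)} := fun t =>
    measurable_history hY.measurable_output t (Set.toFinite {y | IsActive S t y}).measurableSet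
  calc ∫⁻ ω, (stoppingTime μ θ Y ε ω : ℝ≥0∞) ∂μ
      ≤ ∫⁻ ω, ∑' t, {ω | IsActive S t (history Y t ω)}.indicator 1 ω ∂μ := by
        refine lintegral_mono fun ω => ?_
        classical
        refine (iInf_coe_le_tsum (S := fun t => ∃ i, 1 - ε ≤
          _root_.posterior μ θ Y i t (history Y t ω))).trans (le_of_eq ?_)
        refine tsum_congr fun t => ?_
        simp only [Set.indicator_apply, Set.mem_ofPred_eq, isActive_history, hS, Pi.one_apply]
    _ = ∑' t, μ {ω | IsActive S t (history Y t ω)} := by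
        rw [lintegral_tsum fun t => (measurable_one.indicator (hmeas t)).aemeasurable]
        simp only [lintegral_indicator_one (hmeas _)]
    _ ≤ ENNReal.ofReal c := by
        refine ENNReal.tsum_le_of_sum_range_le fun n => ?_
        refine le_trans ?_ (ENNReal.ofReal_le_ofReal (h n))
        rw [ENNReal.ofReal_sum_of_nonneg fun t _ => Finset.sum_nonneg fun i _ =>
          Finset.sum_nonneg fun y _ => by split_ifs; exacts [measureReal_nonneg, le_rfl]]
        refine Finset.sum_le_sum fun t _ => ?_
        rw [← ofReal_measureReal]
        exact ENNReal.ofReal_le_ofReal (measureReal_history_mem_le t (IsActive S t))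

theorem logOdds_lt_of_posterior_lt [IsProbabilityMeasure μ] (hp₀ : 0 < p) (hp₁ : p < 1)
    (hY : IsFeedbackTransmission μ (bsc p) e θ Y) (hM : 2 ≤ M) {ε : ℝ} (hε₀ : 0 < ε)
    {i : Fin M} {t : ℕ} {y : Fin t → Fin 2} (h : _root_.posterior μ θ Y i t y < 1 - ε) :
    logOdds μ θ Y i t y < Real.logb 2 ((1 - ε) / ε) := by
  have hw := jointMass_pos hp₀ hp₁ hY i t y
  have hR := otherMass_pos hp₀ hp₁ hY hM i t y
  rw [posterior_eq hY, ← jointMass_add_otherMass i, div_lt_iff₀ (by positivity)] at h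
  refine Real.logb_lt_logb (by norm_num) (by positivity) ?_
  rw [div_lt_div_iff₀ hR hε₀]
  linarith

/-- Supermartingale bound for the masses of the active histories. -/
theorem sum_active_jointMass_le [IsProbabilityMeasure μ] (hp₀ : 0 < p) (hp₁ : p < 1)
    (hY : IsFeedbackTransmission μ (bsc p) e θ Y) (i : Fin M)
    {S : (t : ℕ) → (Fin t → Fin 2) → Prop} [∀ t, DecidablePred (IsActive S t)]
    (V : (t : ℕ) → (Fin t → Fin 2) → ℝ)
    (hV₀ : ∀ y, 0 ≤ V 0 y)
    (hV : ∀ t y, IsActive S t y → ∀ b, 0 ≤ V (t + 1) (Fin.snoc y b))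
    (hstep : ∀ t y, IsActive S t y → ∑ b, bsc p (e t i y) b * V (t + 1) (Fin.snoc y b)
      ≤ V t y - 1) (n : ℕ) :
    ∑ t ∈ Finset.range n, ∑ y, (if IsActive S t y then jointMass μ θ Y i t y else 0)
      ≤ 1 / M * V 0 Fin.elim0 := by
  -- Induction needs the potential left on the active histories of length `n`.
  have key : ∀ n, ∑ t ∈ Finset.range n, ∑ y, (if IsActive S t y then jointMass μ θ Y i t y else 0)
      + ∑ y, (if IsActive S n y then jointMass μ θ Y i n y * V n y else 0)
      ≤ 1 / M * V 0 Fin.elim0 := by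
    intro n
    induction n with
    | zero =>
      rw [Finset.range_zero, Finset.sum_empty, zero_add, Fintype.sum_unique, jointMass_zero hY]
      split_ifs
      · exact le_of_eq (by congr)
      · exact mul_nonneg (by positivity) (hV₀ _)
    | succ n ih =>
      refine le_trans ?_ ih
      rw [Finset.sum_range_succ, add_assoc]
      refine add_le_add_right ?_ _
      rw [sum_snoc, ← Finset.sum_add_distrib]
      refine Finset.sum_le_sum fun y _ => ?_
      have hw := (jointMass_pos hp₀ hp₁ hY i n y).le
      have hsnoc : ∀ b, IsActive S (n + 1) (Fin.snoc y b) → IsActive S n y := by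
        intro b hb
        have := hb.1
        rwa [Fin.init_snoc] at this
      by_cases hy : IsActive S n y
      · rw [if_pos hy, if_pos hy]
        calc _ ≤ jointMass μ θ Y i n y + ∑ b, jointMass μ θ Y i n y *
              (bsc p (e n i y) b * V (n + 1) (Fin.snoc y b)) := by
              refine add_le_add_right (Finset.sum_le_sum fun b _ => ?_) _
              rw [jointMass_succ hY, ← mul_assoc]
              -- Halted children are dropped; their potential is nonnegative.
              split_ifs
              · exact le_rfl
              · exact mul_nonneg (mul_nonneg hw (bsc_pos hp₀ hp₁ _ _).le) (hV n y hy b)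
          _ ≤ jointMass μ θ Y i n y + jointMass μ θ Y i n y * (V n y - 1) := by
              rw [← Finset.mul_sum]
              gcongr
              exact hstep n y hy
          _ = _ := by ring
      · rw [if_neg hy, if_neg hy, zero_add]
        exact (Finset.sum_eq_zero fun b _ => if_neg fun hb => hy (hsnoc b hb)).le
  refine le_trans (le_add_of_nonneg_right ?_) (key n)
  refine Finset.sum_nonneg fun y _ => ?_
  split_ifs with hy
  · refine mul_nonneg (jointMass_pos hp₀ hp₁ hY i n y).le ?_
    cases n with
    | zero => exact hV₀ y
    | succ n => exact Fin.snoc_init_self y ▸ hV n _ hy.1 _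
  · exact le_rfl

theorem logOdds_zero [IsProbabilityMeasure μ] (hY : IsFeedbackTransmission μ W e θ Y)
    (i : Fin M) (y : Fin 0 → Fin 2) :
    logOdds μ θ Y i 0 y = -Real.logb 2 (M - 1) := by
  have : (0 : ℝ) < M := by exact_mod_cast i.pos
  rw [logOdds, jointMass_zero hY, otherMass_zero hY, ← Real.logb_inv]
  congr 1
  rw [mul_comm, ← div_div, div_self (by positivity), one_div]

theorem stoppingTime_eq_zero_of_subsingleton [IsProbabilityMeasure μ]
    (hY : IsFeedbackTransmission μ W e θ Y) {ε : ℝ} (hε₀ : 0 ≤ ε) (hM : M = 1) (ω : Ω) :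
    stoppingTime μ θ Y ε ω = 0 := by
  subst hM
  refine le_antisymm (iInf₂_le_of_le 0 ⟨0, ?_⟩ (by simp)) bot_le
  rw [posterior_eq hY]
  simp [jointMass_zero hY, hε₀]

end Feedback

/-! ### Assembly of the bound -/

theorem theorem2 {Ω : Type*} [MeasurableSpace Ω] (μ : Measure Ω) [IsProbabilityMeasure μ]
    (p : ℝ) (hp₀ : 0 < p) (hp₁ : p < 1 / 2)
    (ε : ℝ) (hε₀ : 0 < ε) (hε₁ : ε ≤ 1 / 2)
    (M : ℕ)
    (e : (t : ℕ) → Fin M → (Fin t → Fin 2) → Fin 2)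
    (d : (t : ℕ) → (Fin t → Fin 2) → Fin M)
    (θ : Ω → Fin M) (Y : ℕ → Ω → Fin 2)
    (hY : IsFeedbackTransmission μ (bsc p) e θ Y)
    (he : IsSEDEncoder μ e θ Y)
    (hd : IsMAPDecoder μ d θ Y)
    (C C₁ C₂ : ℝ) (hC : C = capacity (bsc p)) (hC₁ : C₁ = maxDivergence (bsc p))
    (hC₂ : C₂ = maxLogRatio (bsc p)) :
    ∫⁻ ω, (stoppingTime μ θ Y ε ω : ℝ≥0∞) ∂μ ≤
      ENNReal.ofReal
        (Real.logb 2 M / C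
          + (⌈Real.logb 2 ((1 - ε) / ε) / C₂⌉ : ℝ) * C₂ / C₁
          + p * C₂ / C₁ * ((C₁ + C₂) / C - C₂ / C₁)
          + C₁ / C) := by
  -- For `M = 1` there is no competing message and the log-odds are meaningless, but transmission
  -- stops at time `0`. A decoder value excludes `M = 0`.
  rcases Nat.lt_or_ge M 2 with hM | hM
  · have : 0 < M := (d 0 Fin.elim0).pos
    simp [stoppingTime_eq_zero_of_subsingleton hY hε₀.le (show M = 1 by omega)]
  classical
  rw [capacity_bsc hp₀ (by linarith)] at hC
  rw [maxLogRatio_bsc hp₁] at hC₂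
  rw [maxDivergence_bsc hp₀ hp₁, ← hC₂] at hC₁
  have hCp := bsc_capacity_pos hp₁ hC
  have hC₂p := bsc_logRatio_pos hp₀ hp₁ hC₂
  have hCle := bsc_capacity_le hp₀ hp₁ hC hC₂ hC₁
  have hC₁p : 0 < C₁ := by
    rw [hC₁]
    exact mul_pos (by linarith) hC₂p
  have hM' : (2 : ℝ) ≤ M := by exact_mod_cast hM
  have hL : 0 ≤ Real.logb 2 ((1 - ε) / ε) :=
    Real.logb_nonneg (by norm_num) ((one_le_div hε₀).2 (by linarith))
  set N := ⌈Real.logb 2 ((1 - ε) / ε) / C₂⌉ with hN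
  have hN₀ : 0 ≤ N := Int.ceil_nonneg (by positivity)
  have hN₀' : (0 : ℝ) ≤ N := by exact_mod_cast hN₀
  have hLN : Real.logb 2 ((1 - ε) / ε) ≤ N * C₂ := (div_le_iff₀ hC₂p).1 (Int.le_ceil _)
  set F := logOddsPotential p C C₁ C₂ (potentialOffset p C C₁ C₂ N) N with hF
  have hbound : Real.logb 2 M / C + (N : ℝ) * C₂ / C₁
      + p * C₂ / C₁ * ((C₁ + C₂) / C - C₂ / C₁) + C₁ / C
      = (potentialOffset p C C₁ C₂ N + Real.logb 2 M) / C := by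
    rw [potentialOffset]
    field_simp
    ring
  have hlog : 0 ≤ Real.logb 2 ((M : ℝ) - 1) := Real.logb_nonneg (by norm_num) (by linarith)
  have hlogM : Real.logb 2 ((M : ℝ) - 1) ≤ Real.logb 2 M :=
    Real.logb_le_logb_of_le (by norm_num) (by linarith) (by linarith)
  have hF₀ : F (-Real.logb 2 (M - 1)) ≤ (potentialOffset p C C₁ C₂ N + Real.logb 2 M) / C := by
    -- For `M = 2` the walk starts at `0`, already in the confirmation branch.
    rcases hlog.eq_or_lt with h | h
    · rw [← h, neg_zero]
      refine (logOddsPotential_zero_le hp₀ hp₁ hC₂p hC₁ hCp).trans ?_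
      gcongr
      linarith
    · rw [hF, logOddsPotential, if_pos (by linarith)]
      gcongr
      linarith
  set S : (t : ℕ) → (Fin t → Fin 2) → Prop :=
    fun t y => ∃ i, 1 - ε ≤ _root_.posterior μ θ Y i t y with hS
  -- Stopping tests every message, so while active the log-odds of each one are below the threshold.
  have hact : ∀ t y, IsActive S t y → ∀ i, logOdds μ θ Y i t y < N * C₂ := by
    intro t y hy i
    refine (logOdds_lt_of_posterior_lt hp₀ (by linarith) hY hM hε₀ ?_).trans_le hLN
    by_contra! hc
    exact hy.not_halted ⟨i, hc⟩
  have hF_nonneg : ∀ u, u < (N + 1) * C₂ → 0 ≤ F u := fun u hu =>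
    logOddsPotential_nonneg hp₀ hp₁ hC₂p hC₁ hCp hCle hN₀ hu
  rw [hbound]
  refine lintegral_stoppingTime_le hY hS fun n => ?_
  rw [Finset.sum_comm]
  have hi : ∀ i, ∑ t ∈ Finset.range n,
      ∑ y, (if IsActive S t y then jointMass μ θ Y i t y else 0)
      ≤ 1 / M * F (-Real.logb 2 (M - 1)) := by
    intro i
    rw [← logOdds_zero hY i Fin.elim0]
    refine sum_active_jointMass_le hp₀ (by linarith) hY i
      (fun t y => F (logOdds μ θ Y i t y)) ?_ ?_ ?_ n
    · intro y
      refine hF_nonneg _ ?_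
      rw [logOdds_zero hY]
      have : 0 < (N + 1) * C₂ := by positivity
      linarith
    · intro t y hy b
      refine hF_nonneg _ ?_
      obtain ⟨w, hw₀, hw₁, -, hstep⟩ := he.exists_logOdds_step hp₀ hp₁ hY hM i t y
      have h1 := hact t y hy i
      have hq : 0 < 1 - p := by linarith
      have hw : 0 < w := by linarith
      have hw' : 0 < 1 - w := by linarith
      have hle : (if b = e t i y then Real.logb 2 ((1 - p) / w) else Real.logb 2 (p / (1 - w)))
          ≤ C₂ := by
        split_ifs
        · rw [hC₂]
          exact Real.logb_le_logb_of_le (by norm_num) (by positivity) (by gcongr)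
        · exact (Real.logb_nonpos (by norm_num) (by positivity)
            ((div_le_one hw').2 (by linarith))).trans hC₂p.le
      rw [hstep]
      linarith
    · intro t y _
      obtain ⟨w, hw₀, hw₁, hw, hstep⟩ := he.exists_logOdds_step hp₀ hp₁ hY hM i t y
      refine le_trans (le_of_eq ?_) (logOddsPotential_bsc_step hp₀ hp₁ hC hC₂ hC₁ hw₀ hw₁ hw)
      simp only [hstep, bsc, Fin.sum_univ_two]
      rcases Fin.exists_fin_two.1 ⟨e t i y, rfl⟩ with h | h
      · simp [h, hF]
      · simp [h, hF, add_comm]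
  refine (Finset.sum_le_sum fun i _ => hi i).trans ?_
  rw [Finset.sum_const, Finset.card_univ, Fintype.card_fin, nsmul_eq_mul, ← mul_assoc,
    mul_one_div_cancel (by positivity), one_mul]
  exact hF₀
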